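/- Formulas are built from countably many propositional letters with $\bot,\wedge,\vee,\to$. A \emph{superintuitionistic logic} (si-logic) is a set of formulas that contains the intuitionistic propositional calculus $\mathsf{IPC}$ and is closed under modus ponens and substitution; si-logics are ordered by inclusion, and $\mathsf{IPC}+\Sigma$ denotes the least si-logic containing $\Sigma$. A formula is \emph{valid} in a poset $X$ if it holds at every point of $X$ under every Kripke valuation of the letters by upsets of $X$. For a class $K$ of posets, $\mathsf{Log}(K)$ is the set of formulas valid in every member of $K$. For an si-logic $\mathsf L$, $\mathsf{Fin}(\mathsf L)$ is the class of finite posets in which all formulas of $\mathsf L$ are valid, and the \emph{fmp span} $\mathrm{fmp}(\mathsf L)$ is the set of si-logics $\mathsf L'$ with $\mathsf{Fin}(\mathsf L')=\mathsf{Fin}(\mathsf L)$. The logic $\mathsf L$ \emph{has the finite model property} (fmp) if every formula valid in all members of $\mathsf{Fin}(\mathsf L)$ belongs to $\mathsf L$. A Heyting algebra is subdirectly irreducible if it has a second largest element. The \emph{Jankov formula} $\mathcal J(A)$ of a finite subdirectly irreducible Heyting algebra $A$ with second largest element $s$ is $\delta_A\to p_s$, where distinct letters $p_a$ are assigned to the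 elements $a\in A$ and $\delta_A$ is the conjunction of $p_0\leftrightarrow\bot$ and of all formulas $p_{a\wedge b}\leftrightarrow p_a\wedge p_b$, $p_{a\vee b}\leftrightarrow p_a\vee p_b$, $p_{a\to b}\leftrightarrow (p_a\to p_b)$ with $a,b\in A$. A poset is rooted if it has a least element, and for a finite rooted poset $X$ we let $\mathcal J(X)$ be the Jankov formula of the Heyting algebra of upsets of $X$. A logic is \emph{axiomatizable by Jankov formulas} if it is $\mathsf{IPC}+\Sigma$ for a set $\Sigma$ of Jankov formulas. \textbf{Theorem.} For an si-logic $\mathsf L$ let $\mathsf L^+=\mathsf{Log}(\mathsf{Fin}(\mathsf L))$ and $\mathsf L^-=\mathsf{IPC}+\{\mathcal J(X) : X \text{ a finite rooted poset},\ X\notin\mathsf{Fin}(\mathsf L)\}$. Then: \begin{enumerate} \item $\mathrm{fmp}(\mathsf L)=[\mathsf L^-,\mathsf L^+]=\{\mathsf L' : \mathsf L' \text{ an si-logic},\ \mathsf L^-\subseteq\mathsf L'\subseteq\mathsf L^+\}$; \item $\mathsf L^+$ is the only member of $\mathrm{fmp}(\mathsf L)$ that has the fmp; \item $\mathsf L^-$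 is the only member of $\mathrm{fmp}(\mathsf L)$ that is axiomatizable by Jankov formulas. \end{enumerate} -/

import Mathlib

/-- Formulas of intuitionistic propositional logic over countably many propositional letters. -/
inductive PropFormula : Type where
  | var : ℕ → PropFormula
  | bot : PropFormula
  | and : PropFormula → PropFormula → PropFormula
  | or : PropFormula → PropFormula → PropFormula
  | imp : PropFormula → PropFormula → PropFormula

namespace PropFormula

/-- The formula `⊤`, as `⊥ → ⊥`. -/
def top : PropFormula := imp bot bot

/-- The biconditional of two formulas. -/
def iff (φ ψ : PropFormula) : PropFormula := and (imp φ ψ) (imp ψ φ)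

/-- The conjunction of a finite list of formulas. -/
def conj : List PropFormula → PropFormula
  | [] => top
  | φ :: l => and φ (conj l)

/-- Simultaneous substitution of formulas for the propositional letters. -/
def subst (σ : ℕ → PropFormula) : PropFormula → PropFormula
  | var n => σ n
  | bot => bot
  | and φ ψ => and (subst σ φ) (subst σ ψ)
  | or φ ψ => or (subst σ φ) (subst σ ψ)
  | imp φ ψ => imp (subst σ φ) (subst σ ψ)

end PropFormula

open PropFormula in
/-- Derivability in the intuitionistic propositional calculus: the standard Hilbert-style
axiom schemes together with modus ponens. -/
inductive IPC : PropFormula → Prop where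
  | imp_k (φ ψ : PropFormula) : IPC (imp φ (imp ψ φ))
  | imp_s (φ ψ χ : PropFormula) :
      IPC (imp (imp φ (imp ψ χ)) (imp (imp φ ψ) (imp φ χ)))
  | and_left (φ ψ : PropFormula) : IPC (imp (and φ ψ) φ)
  | and_right (φ ψ : PropFormula) : IPC (imp (and φ ψ) ψ)
  | and_intro (φ ψ : PropFormula) : IPC (imp φ (imp ψ (and φ ψ)))
  | or_left (φ ψ : PropFormula) : IPC (imp φ (or φ ψ))
  | or_right (φ ψ : PropFormula) : IPC (imp ψ (or φ ψ))
  | or_elim (φ ψ χ : PropFormula) :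
      IPC (imp (imp φ χ) (imp (imp ψ χ) (imp (or φ ψ) χ)))
  | bot_elim (φ : PropFormula) : IPC (imp bot φ)
  | mp {φ ψ : PropFormula} : IPC (imp φ ψ) → IPC φ → IPC ψ

/-! ### Superintuitionistic logics -/

/-- A superintuitionistic logic (si-logic): a set of formulas that contains `IPC` and is closed
under modus ponens and substitution. -/
@[ext]
structure SILogic where
  carrier : Set PropFormula
  ipc_mem : ∀ φ, IPC φ → φ ∈ carrier
  mp_mem : ∀ φ ψ, PropFormula.imp φ ψ ∈ carrier → φ ∈ carrier → ψ ∈ carrier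
  subst_mem : ∀ (σ : ℕ → PropFormula) φ, φ ∈ carrier → φ.subst σ ∈ carrier

namespace SILogic

instance : Membership PropFormula SILogic := ⟨fun L φ => φ ∈ L.carrier⟩

/-- `Ext IPC`: the si-logics ordered by set inclusion. -/
instance : PartialOrder SILogic :=
  PartialOrder.lift SILogic.carrier (fun _ _ h => SILogic.ext h)

/-- `IPC + S`: the least si-logic containing `S`, that is, the intersection of all si-logics
containing `S`. -/
def axiomatizedBy (S : Set PropFormula) : SILogic where
  carrier := {φ | ∀ L : SILogic, S ⊆ L.carrier → φ ∈ L.carrier}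
  ipc_mem φ h L _ := L.ipc_mem φ h
  mp_mem φ ψ h₁ h₂ L hL := L.mp_mem φ ψ (h₁ L hL) (h₂ L hL)
  subst_mem σ φ h L hL := L.subst_mem σ φ (h L hL)

end SILogic

/-! ### Kripke semantics on posets -/

/-- Satisfaction of a formula at a point of the poset `X` under a valuation `ν` that assigns an
upset of `X` to each propositional letter. -/
def Forces {X : Type} [PartialOrder X] (ν : ℕ → UpperSet X) : X → PropFormula → Prop
  | x, .var n => x ∈ ν n
  | _, .bot => False
  | x, .and φ ψ => Forces ν x φ ∧ Forces ν x ψ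
  | x, .or φ ψ => Forces ν x φ ∨ Forces ν x ψ
  | x, .imp φ ψ => ∀ y, x ≤ y → Forces ν y φ → Forces ν y ψ

/-- Validity of a formula in a poset. -/
def ValidIn (X : Type) [PartialOrder X] (φ : PropFormula) : Prop :=
  ∀ (ν : ℕ → UpperSet X) (x : X), Forces ν x φ

theorem Forces.mono {X : Type} [PartialOrder X] {ν : ℕ → UpperSet X} {φ : PropFormula} :
    ∀ {x y : X}, x ≤ y → Forces ν x φ → Forces ν y φ := by
  induction φ with
  | var n => intro x y h hx; exact (ν n).upper h hx
  | bot => intro x y _ hx; exact hx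
  | and φ ψ h₁ h₂ => intro x y h hx; exact ⟨h₁ h hx.1, h₂ h hx.2⟩
  | or φ ψ h₁ h₂ => intro x y h hx; exact hx.imp (h₁ h) (h₂ h)
  | imp φ ψ _ _ => intro x y h hx z hz; exact hx z (h.trans hz)

theorem ValidIn.of_ipc {X : Type} [PartialOrder X] {φ : PropFormula} (h : IPC φ) :
    ValidIn X φ := by
  intro ν
  induction h with
  | imp_k φ ψ => intro x y _ hφ z hz _; exact hφ.mono hz
  | imp_s φ ψ χ =>
    intro x y _ h₁ z hz h₂ w hw hφ
    exact h₁ w (hz.trans hw) hφ w le_rfl (h₂ w hw hφ)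
  | and_left φ ψ => intro x y _ h; exact h.1
  | and_right φ ψ => intro x y _ h; exact h.2
  | and_intro φ ψ => intro x y _ hφ z hz hψ; exact ⟨hφ.mono hz, hψ⟩
  | or_left φ ψ => intro x y _ h; exact Or.inl h
  | or_right φ ψ => intro x y _ h; exact Or.inr h
  | or_elim φ ψ χ =>
    intro x y _ h₁ z hz h₂ w hw h
    exact h.elim (h₁ w (hz.trans hw)) (h₂ w hw)
  | bot_elim φ => intro x y _ h; exact h.elim
  | mp _ _ h₁ h₂ => intro x; exact h₁ x x le_rfl (h₂ x)

theorem forces_subst {X : Type} [PartialOrder X] (ν : ℕ → UpperSet X) (σ : ℕ → PropFormula)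
    (φ : PropFormula) : ∀ x : X, Forces ν x (φ.subst σ) ↔
      Forces (fun n => ⟨{y | Forces ν y (σ n)}, fun _ _ h hx => Forces.mono h hx⟩) x φ := by
  induction φ with
  | var n => intro x; exact Iff.rfl
  | bot => intro x; exact Iff.rfl
  | and φ ψ h₁ h₂ => intro x; exact and_congr (h₁ x) (h₂ x)
  | or φ ψ h₁ h₂ => intro x; exact or_congr (h₁ x) (h₂ x)
  | imp φ ψ h₁ h₂ =>
    intro x
    exact forall_congr' fun y => imp_congr_right fun _ => imp_congr (h₁ y) (h₂ y)

/-- `Log K`: the si-logic of the formulas valid in each member of a class `K` of posets. -/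
def Log (K : Set PartOrd.{0}) : SILogic where
  carrier := {φ | ∀ X ∈ K, ValidIn X φ}
  ipc_mem _ h _ _ := ValidIn.of_ipc h
  mp_mem _ _ h₁ h₂ X hX ν x := h₁ X hX ν x x le_rfl (h₂ X hX ν x)
  subst_mem σ φ h X hX ν x := (forces_subst ν σ φ x).2 (h X hX _ x)

namespace SILogic

/-- `Fr(L)`: the posets validating `L`. -/
def Fr (L : SILogic) : Set PartOrd.{0} := {X | ∀ φ ∈ L, ValidIn X φ}

/-- `Fin(L)`: the finite posets validating `L`. -/
def FinFr (L : SILogic) : Set PartOrd.{0} := {X | X ∈ L.Fr ∧ Finite X}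

/-- The fmp span of `L`: the si-logics with the same finite posets as `L`. -/
def fmpSpan (L : SILogic) : Set SILogic := {L' | L'.FinFr = L.FinFr}

/-- The finite model property: `L` is complete with respect to `Fin(L)`. -/
def HasFMP (L : SILogic) : Prop := ∀ φ, (∀ X ∈ L.FinFr, ValidIn X φ) → φ ∈ L

end SILogic

/-! ### Jankov formulas -/

/-- `s` is the second largest element of the ordered set `A` with top. -/
def IsSecondLargest {A : Type} [HeytingAlgebra A] (s : A) : Prop :=
  s ≠ ⊤ ∧ ∀ a : A, a ≠ ⊤ → a ≤ s

/-- A Heyting algebra is subdirectly irreducible when it has a second largest element. -/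
def IsSI (A : Type) [HeytingAlgebra A] : Prop := ∃ s : A, IsSecondLargest s

/-- The propositional letter `p_a` of an element `a` of a finite algebra; distinct elements have
distinct letters. -/
noncomputable def letter {A : Type} [Finite A] (a : A) : PropFormula :=
  .var (Finite.equivFin A a)

/-- A list of all elements of a finite type. -/
noncomputable def elements (A : Type) [Finite A] : List A :=
  (List.finRange (Nat.card A)).map (Finite.equivFin A).symm

open PropFormula in
/-- The diagram of a finite Heyting algebra: the conjunction of `p_⊥ ↔ ⊥` and of the formulas
`p_{a ∧ b} ↔ p_a ∧ p_b`, `p_{a ∨ b} ↔ p_a ∨ p_b`, `p_{a → b} ↔ (p_a → p_b)` for all `a`, `b`. -/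
noncomputable def diagram (A : Type) [HeytingAlgebra A] [Finite A] : PropFormula :=
  and (iff (letter (⊥ : A)) bot)
    (conj ((elements A).flatMap fun a => (elements A).map fun b =>
      and (iff (letter (a ⊓ b)) (and (letter a) (letter b)))
        (and (iff (letter (a ⊔ b)) (or (letter a) (letter b)))
          (iff (letter (a ⇨ b)) (imp (letter a) (letter b))))))

/-- The Jankov formula `J(A)` of a finite subdirectly irreducible Heyting algebra `A`: the diagram
of `A` implies `p_s`, where `s` is the second largest element of `A`. -/
noncomputable def jankovAlg (A : Type) [HeytingAlgebra A] [Finite A] (h : IsSI A) : PropFormula :=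
  .imp (diagram A) (letter h.choose)

/-- `Up(X)`: the Heyting algebra of upsets of `X`, ordered by inclusion. Mathlib orders
`UpperSet X` by reverse inclusion, hence the order dual. -/
abbrev Up (X : Type) [PartialOrder X] : Type := (UpperSet X)ᵒᵈ

/-- A poset is rooted if it has a least element. -/
def Rooted (X : Type) [PartialOrder X] : Prop := ∃ x : X, ∀ y, x ≤ y

theorem isSI_up {X : Type} [PartialOrder X] (h : Rooted X) : IsSI (Up X) := by
  obtain ⟨r, hr⟩ := h
  refine ⟨OrderDual.toDual (UpperSet.Ioi r), fun h => ?_, fun U hU => ?_⟩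
  · have h' : UpperSet.Ioi r = ⊥ := h
    have : r ∈ UpperSet.Ioi r := h' ▸ UpperSet.mem_bot
    exact lt_irrefl r this
  · intro x hx
    change r < x
    refine lt_of_le_of_ne (hr x) ?_
    rintro rfl
    refine hU ?_
    change OrderDual.ofDual U = ⊥
    ext y
    exact ⟨fun _ => trivial, fun _ => (OrderDual.ofDual U).upper (hr y) hx⟩

/-- The Jankov formula `J(X)` of a finite rooted poset `X` is that of the algebra `Up(X)`. -/
noncomputable def jankov (X : Type) [PartialOrder X] [Finite X] (h : Rooted X) : PropFormula :=
  haveI : Finite (Up X) := Finite.of_injective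
    (f := fun U : Up X => ((OrderDual.ofDual U : UpperSet X) : Set X))
    (SetLike.coe_injective (A := UpperSet X))
  jankovAlg (Up X) (isSI_up h)

/-- The Jankov formulas are those of finite subdirectly irreducible Heyting algebras. -/
def IsJankovFormula (φ : PropFormula) : Prop :=
  ∃ (A : Type) (_ : HeytingAlgebra A) (_ : Finite A) (h : IsSI A), φ = jankovAlg A h

namespace SILogic

/-- `L` is axiomatizable by Jankov formulas. -/
def JankovAxiomatizable (L : SILogic) : Prop :=
  ∃ S : Set PropFormula, (∀ φ ∈ S, IsJankovFormula φ) ∧ L = axiomatizedBy S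

/-- `L⁺ = Log(Fin(L))`. -/
def plus (L : SILogic) : SILogic := Log L.FinFr

/-- `L⁻ = IPC + {J(X) : X ∉ Fin(L)}`, where `X` ranges over the finite rooted posets. -/
noncomputable def minus (L : SILogic) : SILogic :=
  axiomatizedBy {φ | ∃ (X : PartOrd.{0}) (_ : Finite X) (h : Rooted X),
    X ∉ L.FinFr ∧ φ = jankov X h}

end SILogic

/-! Everything rests on Jankov's lemma: an si-logic `L` omits `J(A)` only if `A` validates `L`,
while `A` itself refutes `J(A)`. The first half (`algValid_of_jankovAlg_notMem`) is syntactic: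
modulo the diagram the letters `p_a` compute as the elements of `A`, so if `A` refutes a theorem of
`L`, a substitution instance of that theorem yields `J(A)`.

Taking `A = Up(X)`, each `J(X)` with `X` outside `Fin(L)` lies in `L`, so `L⁻ ≤ L`; and `L ≤ L⁺` is
immediate. Conversely a finite poset validating `L⁻` has all its rooted upsets `Set.Ici x` in
`Fin(L)`, hence is itself in `Fin(L)`. So both bounds have the finite posets of `L`, and since `Fin`
is antitone so does everything between them. Uniqueness follows because an fmp logic, and likewise a
Jankov axiomatizable one, is determined by its finite posets. -/

namespace PropFormula

/-- The value of a formula in a Heyting algebra under a valuation of the letters. -/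
def eval {A : Type} [HeytingAlgebra A] (v : ℕ → A) : PropFormula → A
  | var n => v n
  | bot => ⊥
  | and φ ψ => eval v φ ⊓ eval v ψ
  | or φ ψ => eval v φ ⊔ eval v ψ
  | imp φ ψ => eval v φ ⇨ eval v ψ

theorem eval_orderIso {A B : Type} [HeytingAlgebra A] [HeytingAlgebra B] (e : A ≃o B)
    (v : ℕ → A) (φ : PropFormula) : eval (fun n => e (v n)) φ = e (eval v φ) := by
  induction φ with
  | var n => rfl
  | bot => exact (map_bot e).symm
  | and φ ψ h₁ h₂ => simp [eval, h₁, h₂]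
  | or φ ψ h₁ h₂ => simp [eval, h₁, h₂]
  | imp φ ψ h₁ h₂ => simp [eval, h₁, h₂, map_himp]

end PropFormula

open PropFormula

/-- Validity of a formula in a Heyting algebra. -/
def AlgValid (A : Type) [HeytingAlgebra A] (φ : PropFormula) : Prop :=
  ∀ v : ℕ → A, eval v φ = ⊤

theorem algValid_congr {A B : Type} [HeytingAlgebra A] [HeytingAlgebra B] (e : A ≃o B)
    (φ : PropFormula) : AlgValid A φ ↔ AlgValid B φ := by
  constructor
  · intro h v
    have := eval_orderIso e (fun n => e.symm (v n)) φ
    rw [h] at this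
    simpa using this
  · intro h v
    have := eval_orderIso e v φ
    rw [h] at this
    simpa using this.symm

/-! ### Kripke semantics and the algebra of upsets -/

section Upsets

variable {X : Type} [PartialOrder X]

/-- A point lies in an upset iff its principal upset is contained in it; the adjunction defining `⇨`
then gives the Kripke clause for implication. -/
theorem mem_himp_up (a b : Up X) (x : X) :
    x ∈ OrderDual.ofDual (a ⇨ b) ↔
      ∀ y, x ≤ y → y ∈ OrderDual.ofDual a → y ∈ OrderDual.ofDual b := by
  have key : x ∈ OrderDual.ofDual (a ⇨ b) ↔ OrderDual.toDual (UpperSet.Ici x) ≤ a ⇨ b := by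
    constructor
    · intro h y hy
      exact (OrderDual.ofDual (a ⇨ b)).upper hy h
    · intro h
      exact h (show x ∈ UpperSet.Ici x from le_rfl)
  rw [key, le_himp_iff]
  constructor
  · intro h y hxy hy
    exact h (show y ∈ UpperSet.Ici x ⊔ OrderDual.ofDual a from ⟨hxy, hy⟩)
  · intro h y hy
    exact h y hy.1 hy.2

theorem mem_eval_up (v : ℕ → Up X) (φ : PropFormula) :
    ∀ x : X, x ∈ OrderDual.ofDual (eval v φ) ↔
      Forces (fun n => OrderDual.ofDual (v n)) x φ := by
  induction φ with
  | var n => intro x; exact Iff.rfl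
  | bot => intro x; exact iff_of_false (UpperSet.notMem_top) id
  | and φ ψ h₁ h₂ => intro x; exact and_congr (h₁ x) (h₂ x)
  | or φ ψ h₁ h₂ => intro x; exact or_congr (h₁ x) (h₂ x)
  | imp φ ψ h₁ h₂ =>
    intro x
    refine (mem_himp_up _ _ x).trans ?_
    exact forall_congr' fun y => imp_congr_right fun _ => imp_congr (h₁ y) (h₂ y)

theorem algValid_up (φ : PropFormula) : AlgValid (Up X) φ ↔ ValidIn X φ := by
  constructor
  · intro h ν x
    have := mem_eval_up (fun n => OrderDual.toDual (ν n)) φ x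
    rw [h] at this
    exact this.1 (show x ∈ (⊥ : UpperSet X) from UpperSet.mem_bot)
  · intro h v
    rw [eq_top_iff]
    intro x _
    exact (mem_eval_up v φ x).2 (h _ x)

/-- The upset of `X` generated by an upset of `Set.Ici x`. -/
def upperSetOfIci (x : X) (U : UpperSet (Set.Ici x)) : UpperSet X where
  carrier := Subtype.val '' (U : Set (Set.Ici x))
  upper' := by
    rintro a b hab ⟨c, hc, rfl⟩
    exact ⟨⟨b, c.2.trans hab⟩, U.upper (show c ≤ ⟨b, c.2.trans hab⟩ from hab) hc, rfl⟩

theorem forces_Ici (x : X) (μ : ℕ → UpperSet (Set.Ici x)) (ν : ℕ → UpperSet X)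
    (h : ∀ n (y : Set.Ici x), y ∈ μ n ↔ (y : X) ∈ ν n) (φ : PropFormula) :
    ∀ y : Set.Ici x, Forces μ y φ ↔ Forces ν (y : X) φ := by
  induction φ with
  | var n => intro y; exact h n y
  | bot => intro y; exact Iff.rfl
  | and φ ψ h₁ h₂ => intro y; exact and_congr (h₁ y) (h₂ y)
  | or φ ψ h₁ h₂ => intro y; exact or_congr (h₁ y) (h₂ y)
  | imp φ ψ h₁ h₂ =>
    intro y
    constructor
    · intro H z hz hφ
      exact (h₂ ⟨z, le_trans y.2 hz⟩).1 (H ⟨z, le_trans y.2 hz⟩ hz ((h₁ ⟨z, le_trans y.2 hz⟩).2 hφ))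
    · intro H z hz hφ
      exact (h₂ z).2 (H z hz ((h₁ z).1 hφ))

/-- Forcing at a point only looks upward. This reduces arbitrary posets to rooted ones, for which
Jankov formulas exist. -/
theorem validIn_iff_Ici (φ : PropFormula) :
    ValidIn X φ ↔ ∀ x : X, ValidIn (Set.Ici x) φ := by
  constructor
  · intro h x μ y
    refine (forces_Ici x μ (fun n => upperSetOfIci x (μ n)) ?_ φ y).2 (h _ _)
    intro n y
    exact ⟨fun hy => ⟨y, hy, rfl⟩, fun ⟨z, hz, hzy⟩ => Subtype.ext hzy ▸ hz⟩
  · intro h ν x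
    exact (forces_Ici x (fun n => ⟨{y | (y : X) ∈ ν n}, fun _ _ hab ha => (ν n).upper hab ha⟩) ν
      (fun _ _ => Iff.rfl) φ ⟨x, Set.mem_Ici.2 le_rfl⟩).1 (h x _ _)

theorem rooted_Ici (x : X) : Rooted (Set.Ici x) :=
  ⟨⟨x, Set.mem_Ici.2 le_rfl⟩, fun y => y.2⟩

end Upsets

/-- Every finite Heyting algebra is isomorphic to the algebra of upsets of a finite poset. -/
theorem exists_orderIso_up (A : Type) [HeytingAlgebra A] [Finite A] :
    ∃ X : PartOrd.{0}, Finite X ∧ Nonempty (A ≃o Up X) := by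
  classical
  have := Fintype.ofFinite A
  -- Birkhoff duality represents `A` by lower sets of sup-irreducibles; reversing their order turns
  -- these into upsets.
  refine ⟨PartOrd.of {a : A // SupIrred a}ᵒᵈ,
    inferInstanceAs (Finite {a : A // SupIrred a}), ⟨OrderIso.lowerSetSupIrred.trans ?_⟩⟩
  exact
    { toFun := fun U => OrderDual.toDual
        ⟨{x | OrderDual.ofDual x ∈ U}, fun _ _ hab ha => U.lower hab ha⟩
      invFun := fun V => ⟨{x | OrderDual.toDual x ∈ OrderDual.ofDual V},
        fun _ _ hab ha => (OrderDual.ofDual V).upper hab ha⟩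
      left_inv := fun _ => rfl
      right_inv := fun _ => rfl
      map_rel_iff' := Iff.rfl }

/-! ### Theories -/

/-- A theory: a set of formulas containing `IPC` and closed under modus ponens. -/
structure IsTheory (D : Set PropFormula) : Prop where
  ipc : ∀ {φ}, IPC φ → φ ∈ D
  mp : ∀ {φ ψ}, imp φ ψ ∈ D → φ ∈ D → ψ ∈ D

namespace IsTheory

variable {D : Set PropFormula} (hD : IsTheory D) {φ ψ χ φ' ψ' : PropFormula}
include hD

theorem weaken (h : φ ∈ D) : imp ψ φ ∈ D := hD.mp (hD.ipc (.imp_k _ _)) h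

theorem mp_under (h₁ : imp χ (imp φ ψ) ∈ D) (h₂ : imp χ φ ∈ D) : imp χ ψ ∈ D :=
  hD.mp (hD.mp (hD.ipc (.imp_s _ _ _)) h₁) h₂

theorem imp_trans (h₁ : imp φ ψ ∈ D) (h₂ : imp ψ χ ∈ D) : imp φ χ ∈ D :=
  hD.mp_under (hD.weaken h₂) h₁

theorem imp_self : imp φ φ ∈ D :=
  hD.mp_under (hD.ipc (.imp_k φ (imp φ φ))) (hD.ipc (.imp_k φ φ))

theorem imp_and (h₁ : imp χ φ ∈ D) (h₂ : imp χ ψ ∈ D) : imp χ (and φ ψ) ∈ D :=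
  hD.mp_under (hD.imp_trans h₁ (hD.ipc (.and_intro φ ψ))) h₂

theorem or_imp (h₁ : imp φ χ ∈ D) (h₂ : imp ψ χ ∈ D) : imp (or φ ψ) χ ∈ D :=
  hD.mp (hD.mp (hD.ipc (.or_elim _ _ _)) h₁) h₂

theorem imp_mono (h₁ : imp φ' φ ∈ D) (h₂ : imp ψ ψ' ∈ D) :
    imp (imp φ ψ) (imp φ' ψ') ∈ D := by
  refine hD.imp_trans (ψ := imp φ' ψ) ?_ (hD.mp (hD.ipc (.imp_s _ _ _)) (hD.weaken h₂))
  exact hD.mp_under (hD.imp_trans (hD.ipc (.imp_k _ φ')) (hD.ipc (.imp_s _ _ _))) (hD.weaken h₁)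

theorem and_mem_iff : and φ ψ ∈ D ↔ φ ∈ D ∧ ψ ∈ D :=
  ⟨fun h => ⟨hD.mp (hD.ipc (.and_left _ _)) h, hD.mp (hD.ipc (.and_right _ _)) h⟩,
    fun h => hD.mp (hD.mp (hD.ipc (.and_intro _ _)) h.1) h.2⟩

theorem iff_mem_iff : iff φ ψ ∈ D ↔ imp φ ψ ∈ D ∧ imp ψ φ ∈ D := hD.and_mem_iff

theorem iff_trans (h₁ : iff φ ψ ∈ D) (h₂ : iff ψ χ ∈ D) : iff φ χ ∈ D := by
  rw [hD.iff_mem_iff] at *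
  exact ⟨hD.imp_trans h₁.1 h₂.1, hD.imp_trans h₂.2 h₁.2⟩

theorem iff_and (h₁ : iff φ φ' ∈ D) (h₂ : iff ψ ψ' ∈ D) : iff (and φ ψ) (and φ' ψ') ∈ D := by
  rw [hD.iff_mem_iff] at *
  have l {α β : PropFormula} : imp (and α β) α ∈ D := hD.ipc (.and_left _ _)
  have r {α β : PropFormula} : imp (and α β) β ∈ D := hD.ipc (.and_right _ _)
  exact ⟨hD.imp_and (hD.imp_trans l h₁.1) (hD.imp_trans r h₂.1),
    hD.imp_and (hD.imp_trans l h₁.2) (hD.imp_trans r h₂.2)⟩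

theorem iff_or (h₁ : iff φ φ' ∈ D) (h₂ : iff ψ ψ' ∈ D) : iff (or φ ψ) (or φ' ψ') ∈ D := by
  rw [hD.iff_mem_iff] at *
  have l {α β : PropFormula} : imp α (or α β) ∈ D := hD.ipc (.or_left _ _)
  have r {α β : PropFormula} : imp β (or α β) ∈ D := hD.ipc (.or_right _ _)
  exact ⟨hD.or_imp (hD.imp_trans h₁.1 l) (hD.imp_trans h₂.1 r),
    hD.or_imp (hD.imp_trans h₁.2 l) (hD.imp_trans h₂.2 r)⟩

theorem iff_imp (h₁ : iff φ φ' ∈ D) (h₂ : iff ψ ψ' ∈ D) : iff (imp φ ψ) (imp φ' ψ') ∈ D := by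
  rw [hD.iff_mem_iff] at *
  exact ⟨hD.imp_mono h₁.2 h₂.1, hD.imp_mono h₁.1 h₂.2⟩

theorem mem_of_conj_mem {l : List PropFormula} (h : conj l ∈ D) : ∀ φ ∈ l, φ ∈ D := by
  induction l with
  | nil => simp
  | cons a l ih =>
    have := hD.and_mem_iff.1 h
    simpa using ⟨this.1, ih this.2⟩

end IsTheory

/-- The formulas implied by `δ` in an si-logic form a theory. -/
theorem SILogic.isTheory_imp (L : SILogic) (δ : PropFormula) :
    IsTheory {φ | imp δ φ ∈ L.carrier} := by
  have hL : IsTheory L.carrier := ⟨fun h => L.ipc_mem _ h, fun h₁ h₂ => L.mp_mem _ _ h₁ h₂⟩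
  exact ⟨fun h => hL.weaken (hL.ipc h), fun h₁ h₂ => hL.mp_under h₁ h₂⟩

/-! ### Jankov formulas -/

theorem mem_elements {A : Type} [Finite A] (a : A) : a ∈ elements A := by
  simp only [elements, List.mem_map]
  exact ⟨Finite.equivFin A a, List.mem_finRange _, by simp⟩

theorem eval_conj_eq_top {A : Type} [HeytingAlgebra A] (v : ℕ → A) {l : List PropFormula} (h : ∀ φ ∈ l, eval v φ = ⊤) :
    eval v (conj l) = ⊤ := by
  induction l with
  | nil => simp [conj, top, eval]
  | cons a l ih =>
    simp only [List.mem_cons, forall_eq_or_imp] at h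
    simp [conj, eval, h.1, ih h.2]

section Jankov

variable {A : Type} [HeytingAlgebra A] [Finite A]

variable {D : Set PropFormula}

theorem letter_iff_of_diagram_mem (hD : IsTheory D) (h : diagram A ∈ D) (a b : A) :
    iff (letter (a ⊓ b)) (and (letter a) (letter b)) ∈ D ∧
      iff (letter (a ⊔ b)) (or (letter a) (letter b)) ∈ D ∧
        iff (letter (a ⇨ b)) (imp (letter a) (letter b)) ∈ D := by
  have := hD.mem_of_conj_mem (hD.and_mem_iff.1 h).2 _
    (List.mem_flatMap.2 ⟨a, mem_elements a, List.mem_map.2 ⟨b, mem_elements b, rfl⟩⟩)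
  rwa [hD.and_mem_iff, hD.and_mem_iff] at this

/-- The diagram lets evaluation in `A` be carried out inside the theory, one connective at a time.
-/
theorem letter_eval_iff_subst (hD : IsTheory D) (h : diagram A ∈ D) (v : ℕ → A)
    (φ : PropFormula) : iff (letter (eval v φ)) (φ.subst fun n => letter (v n)) ∈ D := by
  induction φ with
  | var n => exact hD.iff_mem_iff.2 ⟨hD.imp_self, hD.imp_self⟩
  | bot => exact (hD.and_mem_iff.1 h).1
  | and φ ψ h₁ h₂ => exact hD.iff_trans (letter_iff_of_diagram_mem hD h _ _).1 (hD.iff_and h₁ h₂)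
  | or φ ψ h₁ h₂ => exact hD.iff_trans (letter_iff_of_diagram_mem hD h _ _).2.1 (hD.iff_or h₁ h₂)
  | imp φ ψ h₁ h₂ =>
    exact hD.iff_trans (letter_iff_of_diagram_mem hD h _ _).2.2 (hD.iff_imp h₁ h₂)

theorem letter_imp_of_le (hD : IsTheory D) (h : diagram A ∈ D) {a b : A} (hab : a ≤ b) :
    imp (letter a) (letter b) ∈ D := by
  have h₁ := (hD.iff_mem_iff.1 (letter_iff_of_diagram_mem hD h a b).1).2
  rw [inf_eq_left.2 hab] at h₁
  have h₂ := (hD.iff_mem_iff.1 (letter_iff_of_diagram_mem hD h a b).1).1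
  rw [inf_eq_left.2 hab] at h₂
  exact hD.imp_trans h₂ (hD.ipc (.and_right _ _))

/-- An si-logic that omits the Jankov formula of `A` is validated by `A`. -/
theorem algValid_of_jankovAlg_notMem (h : IsSI A) {L : SILogic}
    (hJ : jankovAlg A h ∉ L.carrier) : ∀ φ ∈ L.carrier, AlgValid A φ := by
  intro φ hφ v
  by_contra hne
  have hD := L.isTheory_imp (diagram A)
  have hL : IsTheory L.carrier := ⟨fun h => L.ipc_mem _ h, fun h₁ h₂ => L.mp_mem _ _ h₁ h₂⟩
  have hδ : diagram A ∈ {φ | imp (diagram A) φ ∈ L.carrier} := hL.imp_self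
  -- A value other than `⊤` lies below the second largest element `s`, so it suffices that the
  -- diagram implies its letter.
  refine hJ (hD.mp (letter_imp_of_le hD hδ (h.choose_spec.2 _ hne)) ?_)
  exact hD.mp (hD.iff_mem_iff.1 (letter_eval_iff_subst hD hδ v φ)).2
    (hL.weaken (L.subst_mem _ _ hφ))

/-- A finite subdirectly irreducible Heyting algebra refutes its Jankov formula. -/
theorem not_algValid_jankovAlg (h : IsSI A) : ¬ AlgValid A (jankovAlg A h) := by
  intro H
  -- The valuation `p_a ↦ a`; the default is harmless, as no other letters occur in `J(A)`.
  let v : ℕ → A := fun n => if hn : n < Nat.card A then (Finite.equivFin A).symm ⟨n, hn⟩ else ⊥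
  have hv (a : A) : eval v (letter a) = a := by simp [letter, eval, v]
  have hδ : eval v (diagram A) = ⊤ := by
    have : eval v (conj ((elements A).flatMap fun a => (elements A).map fun b =>
      and (iff (letter (a ⊓ b)) (and (letter a) (letter b)))
        (and (iff (letter (a ⊔ b)) (or (letter a) (letter b)))
          (iff (letter (a ⇨ b)) (imp (letter a) (letter b)))))) = ⊤ := by
      refine eval_conj_eq_top v fun φ hφ => ?_
      obtain ⟨a, -, hφ⟩ := List.mem_flatMap.1 hφ
      obtain ⟨b, -, rfl⟩ := List.mem_map.1 hφ
      simp only [iff, eval, hv, himp_self, inf_top_eq]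
    simp only [diagram, iff, eval, hv, himp_self, inf_top_eq, top_inf_eq] at this ⊢
    exact this
  have := H v
  rw [jankovAlg, eval, hδ, hv, top_himp] at this
  exact h.choose_spec.1 this

end Jankov

theorem finite_up (X : Type) [PartialOrder X] [Finite X] : Finite (Up X) :=
  Finite.of_injective (f := fun U : Up X => ((OrderDual.ofDual U : UpperSet X) : Set X))
    (SetLike.coe_injective (A := UpperSet X))

theorem isJankovFormula_jankov (X : Type) [PartialOrder X] [Finite X] (h : Rooted X) :
    IsJankovFormula (jankov X h) :=
  ⟨Up X, inferInstance, finite_up X, isSI_up h, rfl⟩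

theorem not_validIn_jankov (X : Type) [PartialOrder X] [Finite X] (h : Rooted X) :
    ¬ ValidIn X (jankov X h) := by
  have := finite_up X
  rw [← algValid_up]
  exact not_algValid_jankovAlg (isSI_up h)

/-! ### The fmp span as an interval -/

namespace SILogic

theorem mem_finFr_of_jankov_notMem {L : SILogic} {X : PartOrd.{0}} [Finite X] {h : Rooted X}
    (hJ : jankov X h ∉ L.carrier) : X ∈ L.FinFr := by
  have := finite_up X
  exact ⟨fun φ hφ => (algValid_up φ).1 (algValid_of_jankovAlg_notMem (isSI_up h) hJ φ hφ), ‹_›⟩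

theorem axiomatizedBy_le {S : Set PropFormula} {L : SILogic} (h : S ⊆ L.carrier) :
    axiomatizedBy S ≤ L := fun _ hφ => hφ L h

theorem subset_axiomatizedBy (S : Set PropFormula) : S ⊆ (axiomatizedBy S).carrier :=
  fun _ hφ _ hL => hL hφ

theorem finFr_antitone {L L' : SILogic} (h : L ≤ L') : L'.FinFr ⊆ L.FinFr :=
  fun _ hX => ⟨fun φ hφ => hX.1 φ (h hφ), hX.2⟩

theorem le_plus (L : SILogic) : L ≤ L.plus := fun φ hφ _ hX => hX.1 φ hφ

theorem minus_le (L : SILogic) : L.minus ≤ L := by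
  refine axiomatizedBy_le ?_
  rintro _ ⟨X, _, h, hX, rfl⟩
  by_contra hJ
  exact hX (mem_finFr_of_jankov_notMem hJ)

theorem minus_congr {L L' : SILogic} (h : L'.FinFr = L.FinFr) : L'.minus = L.minus := by
  rw [minus, minus, h]

theorem plus_congr {L L' : SILogic} (h : L'.FinFr = L.FinFr) : L'.plus = L.plus := by
  rw [plus, plus, h]

/-- If some `Set.Ici x` failed a formula of `L`, its Jankov formula would be an axiom of `L⁻`, hence
valid in `X` and so in `Set.Ici x`, which refutes it. -/
theorem finFr_minus_subset (L : SILogic) : L.minus.FinFr ⊆ L.FinFr := by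
  rintro X ⟨hX, hfin⟩
  refine ⟨fun φ hφ => (validIn_iff_Ici φ).2 fun x => ?_, hfin⟩
  have : Finite X := hfin
  by_contra hx
  have hJ : jankov (PartOrd.of (Set.Ici x)) (rooted_Ici x) ∈ L.minus.carrier :=
    subset_axiomatizedBy _ ⟨PartOrd.of (Set.Ici x), inferInstanceAs (Finite (Set.Ici x)),
      rooted_Ici x, fun h => hx (h.1 φ hφ), rfl⟩
  exact not_validIn_jankov _ _ ((validIn_iff_Ici _).1 (hX _ hJ) x)

theorem finFr_subset_plus (L : SILogic) : L.FinFr ⊆ L.plus.FinFr :=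
  fun X hX => ⟨fun _ hφ => hφ X hX, hX.2⟩

theorem fmpSpan_eq_Icc (L : SILogic) : L.fmpSpan = Set.Icc L.minus L.plus := by
  ext L'
  constructor
  · intro h
    exact ⟨minus_congr h ▸ L'.minus_le, plus_congr h ▸ L'.le_plus⟩
  · rintro ⟨h₁, h₂⟩
    exact ((finFr_antitone h₁).trans L.finFr_minus_subset).antisymm
      (L.finFr_subset_plus.trans (finFr_antitone h₂))

theorem HasFMP.eq_plus {L : SILogic} (h : L.HasFMP) : L = L.plus :=
  L.le_plus.antisymm h

/-- Logics with the same finite frames contain the same Jankov formulas. -/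
theorem jankovAlg_mem_of_finFr_subset {L L' : SILogic} (h : L'.FinFr ⊆ L.FinFr)
    {A : Type} [HeytingAlgebra A] [Finite A] (hA : IsSI A) (hJ : jankovAlg A hA ∈ L.carrier) :
    jankovAlg A hA ∈ L'.carrier := by
  by_contra hJ'
  -- Were `J(A)` missing from `L'`, the dual poset of `A` would validate `L'`, hence `L`, and so
  -- `J(A)`.
  obtain ⟨X, hX, ⟨e⟩⟩ := exists_orderIso_up A
  have hX' : X ∈ L'.FinFr := ⟨fun φ hφ => (algValid_up φ).1
    ((algValid_congr e φ).1 (algValid_of_jankovAlg_notMem hA hJ' φ hφ)), hX⟩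
  exact not_algValid_jankovAlg hA
    ((algValid_congr e _).2 ((algValid_up _).2 ((h hX').1 _ hJ)))

/-- Only the axioms need checking. With equal finite posets this applies in both directions, which
gives uniqueness of `L⁻`. -/
theorem JankovAxiomatizable.le {L L' : SILogic} (hL : L.JankovAxiomatizable)
    (h : L'.FinFr ⊆ L.FinFr) : L ≤ L' := by
  obtain ⟨S, hS, rfl⟩ := hL
  refine axiomatizedBy_le fun φ hφ => ?_
  obtain ⟨A, _, _, hA, rfl⟩ := hS φ hφ
  exact jankovAlg_mem_of_finFr_subset h hA (subset_axiomatizedBy S hφ)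

theorem jankovAxiomatizable_minus (L : SILogic) : L.minus.JankovAxiomatizable := by
  refine ⟨_, ?_, rfl⟩
  rintro _ ⟨X, _, h, -, rfl⟩
  exact isJankovFormula_jankov X h

end SILogic

theorem mainTheorem8 (L : SILogic) :
    L.fmpSpan = Set.Icc L.minus L.plus ∧
    (L.plus ∈ L.fmpSpan ∧ L.plus.HasFMP ∧
      ∀ L' : SILogic, L' ∈ L.fmpSpan → L'.HasFMP → L' = L.plus) ∧
    (L.minus ∈ L.fmpSpan ∧ L.minus.JankovAxiomatizable ∧
      ∀ L' : SILogic, L' ∈ L.fmpSpan → L'.JankovAxiomatizable → L' = L.minus) := by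
  have hle : L.minus ≤ L.plus := L.minus_le.trans L.le_plus
  have hplus : L.plus ∈ L.fmpSpan := L.fmpSpan_eq_Icc ▸ ⟨hle, le_rfl⟩
  have hminus : L.minus ∈ L.fmpSpan := L.fmpSpan_eq_Icc ▸ ⟨le_rfl, hle⟩
  refine ⟨L.fmpSpan_eq_Icc, ⟨hplus, ?_, ?_⟩, hminus, L.jankovAxiomatizable_minus, ?_⟩
  · intro φ hφ X hX
    exact hφ X (L.finFr_subset_plus hX)
  · intro L' h hfmp
    exact hfmp.eq_plus.trans (SILogic.plus_congr h)
  · intro L' h hJ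
    have hFin : L.minus.FinFr = L'.FinFr := Eq.trans hminus (Eq.symm h)
    exact (hJ.le hFin.subset).antisymm (L.jankovAxiomatizable_minus.le hFin.superset)
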